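/- Let $n\ge 3$ and let $P=\sum_{i=0}^n a_ix^i\in\mathbb Z[a_0,\dots,a_n][x]$ be the generic polynomial of degree $n$ with formal coefficients; put $\boldsymbol F=(P,P',\dots,P^{(n)})$, $F_i=P^{(i)}$, $d_i=\deg_x F_i=n-i$. *Subresultants.* For a $p\times q$ matrix $M$ with $p\le q$ and columns $M_1,\dots,M_q$ let $\operatorname{dp}M=\sum_{i=0}^{q-p}\det[M_1,\dots,M_{p-1},M_{q-i}]\,x^i$. For $\delta=(\delta_1,\dots,\delta_t)$, $\delta_i\ge 0$, $1\le t\le n$, not all $\delta_i$ zero, $\sum_i\delta_i\le n$, let $m=\max\{d_i+\delta_i: 1\le i\le t,\ \delta_i\ne0\}$ and let $\delta_0=m-n$ if $m\ge n$, $\delta_0=1$ otherwise. Let $R_\delta=\operatorname{dp}M_\delta$, where $M_\delta$ is the matrix with $\delta_0+n$ columns whose rows are the coefficient vectors (with respect to $x^{\delta_0+n-1},\dots,x^0$) of $x^{\delta_0-1}F_0,\dots,F_0,\ x^{\delta_1-1}F_1,\dots,F_1,\ \dots,\ x^{\delta_t-1}F_t,\dots,F_t$. If $\sum_i\delta_i=n$,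 then $R_\delta\in\mathbb Z[a_0,\dots,a_n]$. *Discriminant sequence.* For a polynomial $Q$ of degree $d\geq 1$ in $x$, $D_j(Q)$ ($1\le j\le d$) is the leading principal $2j\times 2j$ minor of the $2d\times 2d$ matrix whose rows $2k+1$ and $2k+2$ ($0\le k<d$) contain, from column $k+1$ on, the coefficients of $x^d,\dots,x^0$ in $Q$ and in $Q'$, respectively (the first of the latter being $0$), and zeros elsewhere. *Conditions.* Let $\mathcal M(n)$ be the set of $\mu=(\mu_1,\dots,\mu_m)$ with $\mu_1\ge\dots\ge\mu_m\ge1$ and $\sum_j\mu_j=n$. For $\mu\in\mathcal M(n)$ let $\bar\mu_i=\#\{j:\mu_j\ge i\}$, $\bar\mu=(\bar\mu_1,\dots,\bar\mu_n)$ (trailing zeros are immaterial when $\bar\mu$ is compared with elements of $\mathcal M(n)$), $G_0=P$ and $G_i=R_{(\bar\mu_1,\dots,\bar\mu_i)}$ for $i\ge1$. For every $\mu\in\mathcal M(n)$ and every way of splitting the entries of $\mu$ into two weakly decreasing vectors $(\mu_R;\mu_I)$ with $\mu_{I,1}=\mu_{I,2}\ge\mu_{I,3}=\mu_{I,4}\ge\cdots$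 ($\mu_I$ of even length), the algorithm ParametricCompleteMultiplicity outputs, as the condition for $P$ to have real roots of multiplicities $\mu_R$ and imaginary roots of multiplicities $\mu_I$, the conjunction of - $R_\gamma=0$ for all $\gamma\in\mathcal M(n)$ that are lexicographically larger than $\bar\mu$, - $R_{\bar\mu}\ne0$, - $\operatorname{Var}\bigl(D_1(G_i),\dots,D_{\bar\mu_{i+1}}(G_i)\bigr)=\bar\mu_{I,i+1}/2$ for $i=0,\dots,\mu_1-1$, where $\operatorname{Var}$ is the number of sign changes of the revised sign list and $\bar\mu_{I,i}=\#\{j:\mu_{I,j}\ge i\}$. Let $d_{\mathrm{QXY}}$ be the maximum of the total degrees in $a_0,\dots,a_n$ of the polynomials that appear in these conditions (the $R_\gamma$, $R_{\bar\mu}$ and $D_j(G_i)$ above, over all $\mu$ and all splittings). Then $d_{\mathrm{QXY}}=n(n-1)$. -/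

import Mathlib

open Polynomial

noncomputable section

namespace QXY

/-! ### Determinant polynomials and generalized subresultants -/

/-- The determinant polynomial of a `p × q` matrix, `p ≤ q`: the sum over `0 ≤ i ≤ q - p` of
`det [M₁, …, M_{p-1}, M_{q-i}] xⁱ`, where `M_k` is the `k`-th column (counted from `1`). -/
def detPoly {R : Type*} [CommRing R] {p q : ℕ} (h : p ≤ q) (M : Matrix (Fin p) (Fin q) R) :
    R[X] :=
  ∑ i ∈ Finset.range (q - p + 1),
    C (Matrix.det (M.submatrix id
      (fun c : Fin p => (⟨if c.val + 1 < p then c.val else q - 1 - i, by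
        have := c.isLt; split_ifs <;> omega⟩ : Fin q)))) * X ^ i

/-- `max {dᵢ + δᵢ : 1 ≤ i ≤ t, δᵢ ≠ 0}` with `dᵢ = deg Fᵢ`; here `δ = [δ₁, …, δ_t]`. -/
def maxShift {R : Type*} [CommRing R] (F : ℕ → R[X]) (δ : List ℕ) : ℕ :=
  ((Finset.range δ.length).filter (fun k => δ.getD k 0 ≠ 0)).sup
    (fun k => (F (k + 1)).natDegree + δ.getD k 0)

/-- The number `δ₀` of rows of `F₀` in the generalized Sylvester matrix. -/
def deltaZero {R : Type*} [CommRing R] (F : ℕ → R[X]) (δ : List ℕ) : ℕ :=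
  if (F 0).natDegree ≤ maxShift F δ then maxShift F δ - (F 0).natDegree else 1

/-- The polynomials whose coefficients are the rows of the generalized Sylvester matrix:
`x^{δ₀-1} F₀, …, F₀, x^{δ₁-1} F₁, …, F₁, …, x^{δ_t-1} F_t, …, F_t`. -/
def sylvesterRows {R : Type*} [CommRing R] (F : ℕ → R[X]) (δ : List ℕ) : List R[X] :=
  (deltaZero F δ :: δ).zipIdx.flatMap
    (fun di => (List.range di.1).reverse.map (fun k => X ^ k * F di.2))

/-- The `δ`-th generalized Sylvester matrix of `F`; it has `δ₀ + d₀` columns, holding the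
coefficients of `x^{δ₀+d₀-1}, …, x⁰`. -/
def sylvesterMatrix {R : Type*} [CommRing R] (F : ℕ → R[X]) (δ : List ℕ) :
    Matrix (Fin (sylvesterRows F δ).length) (Fin (deltaZero F δ + (F 0).natDegree)) R :=
  Matrix.of fun r c =>
    ((sylvesterRows F δ).get r).coeff (deltaZero F δ + (F 0).natDegree - 1 - c.val)

/-- The `δ`-th subresultant `R_δ(F)`. The matrix is wide or square as soon as
`δ₁ + ⋯ + δ_t ≤ d₀`, the only case in which the subresultant is defined mathematically. -/
def subres {R : Type*} [CommRing R] (F : ℕ → R[X]) (δ : List ℕ) : R[X] :=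
  if h : (sylvesterRows F δ).length ≤ deltaZero F δ + (F 0).natDegree then
    detPoly h (sylvesterMatrix F δ)
  else 0

/-! ### Discriminant sequence -/

/-- The upper left `N × N` block of the discrimination matrix of `Q`. For `d = deg Q` and
`N = 2 d` it is the whole matrix. Rows `2k` and `2k+1` (counted from `0`) hold the coefficients of
`x^d, …, x⁰` in `Q` and in `Q'` respectively, starting at column `k`. -/
def discrBlock {R : Type*} [CommRing R] (Q : R[X]) (N : ℕ) : Matrix (Fin N) (Fin N) R :=
  Matrix.of fun r s =>
    if r.val / 2 ≤ s.val ∧ s.val ≤ r.val / 2 + Q.natDegree then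
      (if r.val % 2 = 0 then Q else derivative Q).coeff (Q.natDegree + r.val / 2 - s.val)
    else 0

/-- The `j`-th member `D_j` (`1 ≤ j ≤ deg Q`) of the discriminant sequence of `Q`:
the `2j × 2j` leading principal minor of the discrimination matrix. -/
def discrSeq {R : Type*} [CommRing R] (Q : R[X]) (j : ℕ) : R :=
  (discrBlock Q (2 * j)).det

/-! ### Multiplicity vectors -/

/-- `μ ∈ M(n)`: `μ₁ ≥ ⋯ ≥ μ_m ≥ 1` with sum `n`. -/
def IsMult (n : ℕ) (μ : List ℕ) : Prop :=
  μ.Pairwise (· ≥ ·) ∧ (∀ a ∈ μ, 1 ≤ a) ∧ μ.sum = n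

/-- `(μR; μI)` is a complete multiplicity for degree `n`: both parts are weakly decreasing and
positive, the entries of `μI` come in equal consecutive pairs, and the total sum is `n`. -/
def IsCompleteMult (n : ℕ) (μR μI : List ℕ) : Prop :=
  μR.Pairwise (· ≥ ·) ∧ (∀ a ∈ μR, 1 ≤ a) ∧
  μI.Pairwise (· ≥ ·) ∧ (∀ a ∈ μI, 1 ≤ a) ∧
  Even μI.length ∧ (∀ k, μI.getD (2 * k) 0 = μI.getD (2 * k + 1) 0) ∧
  μR.sum + μI.sum = n

/-- The `i`-th entry (`i ≥ 1`) of the conjugate of `μ`: the number of `j` with `μ_j ≥ i`. -/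
def conjPart (μ : List ℕ) (i : ℕ) : ℕ := μ.countP (fun a => i ≤ a)

/-- The conjugate `(μ̄₁, …, μ̄_n)` of `μ ∈ M(n)`. -/
def conj (n : ℕ) (μ : List ℕ) : List ℕ := (List.range n).map (fun i => conjPart μ (i + 1))

/-! ### The generic polynomial and the conditions produced by the algorithm -/

/-- The parameter ring `ℤ[a₀, …, a_n]`. -/
abbrev Param (n : ℕ) : Type := MvPolynomial (Fin (n + 1)) ℤ

/-- The generic polynomial `P = a_n xⁿ + ⋯ + a₀` with formal coefficients. -/
def genericPoly (n : ℕ) : (Param n)[X] :=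
  ∑ i : Fin (n + 1), C (MvPolynomial.X i) * X ^ (i : ℕ)

/-- The sequence `F = (P, P', P'', …)` of derivatives of the generic polynomial. -/
def derivs (n : ℕ) (k : ℕ) : (Param n)[X] := derivative^[k] (genericPoly n)

/-- For `γ` with sum `n` the subresultant `R_γ(F)` is free of `x`;
this is that element of `ℤ[a₀, …, a_n]`. -/
def multDiscr (n : ℕ) (γ : List ℕ) : Param n := (subres (derivs n) γ).coeff 0

/-- `G₀ = P` and `G_i = R_{(μ̄₁, …, μ̄_i)}(F)` for `i > 0`. -/
def incGcd (n : ℕ) (μ : List ℕ) (i : ℕ) : (Param n)[X] :=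
  if i = 0 then genericPoly n else subres (derivs n) ((conj n μ).take i)

/-- The atomic conditions on the parameters: `p = 0`, `p ≠ 0`, and `Var(L) = ν`, which says that
the revised sign list of the values of the polynomials in `L` has `ν` sign changes. -/
inductive Atom (n : ℕ) : Type
  | eqZero (p : Param n) : Atom n
  | neZero (p : Param n) : Atom n
  | varEq (L : List (Param n)) (ν : ℕ) : Atom n

/-- The polynomials that appear in an atomic condition. -/
def Atom.polys {n : ℕ} : Atom n → Set (Param n)
  | .eqZero p => {p}
  | .neZero p => {p}
  | .varEq L _ => {p | p ∈ L}

/-- The condition (the conjunction of a set of atoms) that the algorithm attaches to a `2`-partition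
`(μR; μI)` of `μ ∈ M(n)`: `R_γ(F) = 0` for all `γ ∈ M(n)` lexicographically larger than `μ̄`;
`R_{μ̄}(F) ≠ 0`; and `Var(D₁(G_i), …, D_{μ̄_{i+1}}(G_i)) = μ̄_{I,i+1} / 2` for `0 ≤ i ≤ μ₁ - 1`. -/
def condition (n : ℕ) (μ μI : List ℕ) : Set (Atom n) :=
  {A | ∃ γ, IsMult n γ ∧ List.Lex (· < ·) (conj n μ) γ ∧ A = .eqZero (multDiscr n γ)} ∪
  {.neZero (multDiscr n (conj n μ))} ∪
  {A | ∃ i < μ.headD 0,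
    A = .varEq ((List.range (conjPart μ (i + 1))).map (fun j => discrSeq (incGcd n μ i) (j + 1)))
      (conjPart μI (i + 1) / 2)}

/-- The output of the algorithm: all pairs `((μR; μI), C)` where `(μR; μI)` is a `2`-partition of
some `μ ∈ M(n)` and `C` is the condition attached to it. -/
def output (n : ℕ) : Set ((List ℕ × List ℕ) × Set (Atom n)) :=
  {o | ∃ μ μR μI, IsMult n μ ∧ IsCompleteMult n μR μI ∧ (μR ++ μI).Perm μ ∧
    o = ((μR, μI), condition n μ μI)}

/-- The polynomials in `a₀, …, a_n` that appear in the conditions produced by the algorithm. -/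
def conditionPolys (n : ℕ) : Set (Param n) :=
  {p | ∃ o ∈ output n, ∃ A ∈ o.2, p ∈ A.polys}

end QXY

end

namespace QXY

/-! Every polynomial in the conditions is a determinant whose entries share one degree, so it is
homogeneous of known degree; only its nonvanishing needs thought.

Upper bound. For `δ` with largest entry `δ₁` first, `δ₀ = δ₁ - 1`, so the coefficients of `R_δ` have
degree `δ₁ - 1 + |δ| ≤ 2n - 1`. With `δ = (μ̄₁, …, μ̄ᵢ)` and `s = μ̄ᵢ₊₁`, one has `s ≤ δ₁ ≤ |δ| ≤ n
- s`, and `D_j(Gᵢ)`, `j ≤ s`, has degree at most `2s(2n - 2s - 1)`. The two factors are integers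
with sum `2n - 1`, so their product is at most `n(n - 1)`.

Attainment. Equality asks for `s = ⌊n/2⌋`, `t = n - s` and `μ̄ = (t, s)`, and for `D_s(R_(t)) ≠ 0`.
Specialize `P` to `f = g²h` with `g = x^s - 1`, `h = x^(t-s)`: the gcd of `f` and `f'` is `g`, so
`R_(t)` becomes a nonzero multiple of `g` (`map_specialize_subres`), and `D_s` of a separable
polynomial of degree `s` is nonzero (`discrSeq_natDegree_ne_zero`). Both facts rest on
`det_leadingCoeffs_ne_zero` and `shifts_independent`. -/

/-! ### Homogeneous determinants and determinant polynomials -/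

theorem isHomogeneous_det {σ R : Type*} [CommRing R] {N d : ℕ}
    (M : Matrix (Fin N) (Fin N) (MvPolynomial σ R)) (hM : ∀ r c, (M r c).IsHomogeneous d) :
    M.det.IsHomogeneous (N * d) := by
  rw [Matrix.det_apply]
  refine MvPolynomial.IsHomogeneous.sum _ _ _ fun π _ => ?_
  have h : (∏ i, M (π i) i).IsHomogeneous (N * d) := by
    simpa using MvPolynomial.IsHomogeneous.prod Finset.univ (fun i => M (π i) i) (fun _ => d)
      fun i _ => hM _ _
  rw [Units.smul_def, zsmul_eq_mul]
  simpa using (MvPolynomial.isHomogeneous_C σ ((Equiv.Perm.sign π : ℤ) : R)).mul h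

/-- The columns `1, …, p - 1, q - i` selected for the coefficient of `xⁱ` in `detPoly`. -/
def detPolyCols {p q : ℕ} (h : p ≤ q) (i : ℕ) (c : Fin p) : Fin q :=
  ⟨if c.val + 1 < p then c.val else q - 1 - i, by have := c.isLt; split_ifs <;> omega⟩

theorem detPoly_eq {R : Type*} [CommRing R] {p q : ℕ} (h : p ≤ q)
    (M : Matrix (Fin p) (Fin q) R) :
    detPoly h M = ∑ i ∈ Finset.range (q - p + 1),
      C (Matrix.det (M.submatrix id (detPolyCols h i))) * X ^ i := rfl

theorem coeff_detPoly {R : Type*} [CommRing R] {p q : ℕ} (h : p ≤ q)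
    (M : Matrix (Fin p) (Fin q) R) (i : ℕ) :
    (detPoly h M).coeff i =
      if i < q - p + 1 then (M.submatrix id (detPolyCols h i)).det else 0 := by
  simp [detPoly_eq, coeff_C_mul, coeff_X_pow]

theorem isHomogeneous_coeff_detPoly {σ R : Type*} [CommRing R] {p q d : ℕ} (h : p ≤ q)
    (M : Matrix (Fin p) (Fin q) (MvPolynomial σ R)) (hM : ∀ r c, (M r c).IsHomogeneous d)
    (i : ℕ) : ((detPoly h M).coeff i).IsHomogeneous (p * d) := by
  rw [coeff_detPoly]
  split_ifs
  · exact isHomogeneous_det _ fun r c => hM _ _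
  · exact MvPolynomial.isHomogeneous_zero _ _ _

theorem natDegree_detPoly_le {R : Type*} [CommRing R] {p q : ℕ} (h : p ≤ q)
    (M : Matrix (Fin p) (Fin q) R) : (detPoly h M).natDegree ≤ q - p := by
  rw [natDegree_le_iff_coeff_eq_zero]
  intro i hi
  rw [coeff_detPoly, if_neg (by omega)]

theorem map_detPoly {R S : Type*} [CommRing R] [CommRing S] (φ : R →+* S) {p q : ℕ} (h : p ≤ q)
    (M : Matrix (Fin p) (Fin q) R) : (detPoly h M).map φ = detPoly h (M.map φ) := by
  ext i
  rw [coeff_map, coeff_detPoly, coeff_detPoly, apply_ite φ, map_zero, RingHom.map_det]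
  rfl

/-- A common divisor of the polynomials given by the rows divides the determinant polynomial. -/
theorem dvd_detPoly {R : Type*} [CommRing R] {p q : ℕ} (hp : 0 < p) (h : p ≤ q)
    (L : Fin p → R[X]) (hL : ∀ r, (L r).natDegree < q) (g : R[X]) (hg : ∀ r, g ∣ L r) :
    g ∣ detPoly h (Matrix.of fun r (c : Fin q) => (L r).coeff (q - 1 - c.val)) := by
  set M : Matrix (Fin p) (Fin q) R := Matrix.of fun r (c : Fin q) => (L r).coeff (q - 1 - c.val)
  obtain ⟨k, rfl⟩ : ∃ k, p = k + 1 := ⟨p - 1, by omega⟩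
  -- Replacing the last column of `M₀` by the row polynomials themselves gives the determinant
  -- polynomial; Cramer's map is linear in that column, so a common factor pulls out.
  let M₀ : Matrix (Fin (k + 1)) (Fin (k + 1)) R[X] := (M.submatrix id (detPolyCols h 0)).map C
  have hcol : ∀ i < q, C (M.submatrix id (detPolyCols h i)).det =
      M₀.cramer (fun r => C ((L r).coeff i)) (Fin.last k) := by
    intro i hi
    rw [Matrix.cramer_apply, RingHom.map_det]
    congr 1
    ext1 r c
    by_cases hc : c = Fin.last k
    · subst hc
      simp only [RingHom.mapMatrix_apply, Matrix.map_apply, Matrix.submatrix_apply, id,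
        Matrix.updateCol_self, M, Matrix.of_apply, detPolyCols, Fin.val_last, lt_irrefl, if_false]
      congr 2
      omega
    · have : c.val + 1 < k + 1 := by
        have := c.isLt
        have : c.val ≠ k := fun h => hc (Fin.ext h)
        omega
      simp [M₀, Matrix.updateCol_ne hc, detPolyCols, this]
  -- For `q - p < i < q` the column of `xⁱ` is already among the first `p - 1`.
  have hzero : ∀ i ∈ Finset.range q, i ∉ Finset.range (q - (k + 1) + 1) →
      C (M.submatrix id (detPolyCols h i)).det * X ^ i = 0 := by
    intro i hi hi'
    rw [Finset.mem_range] at hi hi'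
    have hlt : q - 1 - i < k := by omega
    rw [Matrix.det_zero_of_column_eq (i := ⟨q - 1 - i, by omega⟩) (j := Fin.last k)]
    · simp
    · intro e
      have := congrArg Fin.val e
      simp at this
      omega
    · intro r
      simp [detPolyCols, hlt]
  have hsum : detPoly h M = M₀.cramer L (Fin.last k) := by
    rw [detPoly_eq, Finset.sum_subset (Finset.range_mono (by omega : q - (k + 1) + 1 ≤ q)) hzero]
    have : L = ∑ i ∈ Finset.range q, (X ^ i : R[X]) • fun r => C ((L r).coeff i) := by
      ext1 r
      rw [Finset.sum_apply]
      conv_lhs => rw [(L r).as_sum_range_C_mul_X_pow' (hL r)]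
      exact Finset.sum_congr rfl fun i _ => by rw [Pi.smul_apply, smul_eq_mul, mul_comm]
    conv_rhs => rw [this]
    rw [map_sum, Finset.sum_apply]
    refine Finset.sum_congr rfl fun i hi => ?_
    rw [map_smul, Pi.smul_apply, hcol i (Finset.mem_range.1 hi), smul_eq_mul, mul_comm]
  choose L' hL' using hg
  have : L = g • L' := funext fun r => by simp [hL' r]
  rw [hsum, this, map_smul, Pi.smul_apply, smul_eq_mul]
  exact dvd_mul_right _ _

/-! ### Nonvanishing of minors -/

/-- If the row polynomials are independent multiples of a polynomial whose degree is at least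
`q - p`, then the minor of the `p` leading coefficients does not vanish. -/
theorem det_leadingCoeffs_ne_zero {K : Type*} [Field K] {p q : ℕ}
    (L : Fin p → K[X]) (hL : ∀ r, (L r).natDegree < q) (g : K[X]) (hg : ∀ r, g ∣ L r)
    (hgq : q ≤ g.natDegree + p) (hind : ∀ v : Fin p → K, ∑ r, C (v r) * L r = 0 → v = 0) :
    (Matrix.of fun (r c : Fin p) => (L r).coeff (q - 1 - c.val)).det ≠ 0 := by
  intro hdet
  obtain ⟨v, hv, hvM⟩ := Matrix.exists_vecMul_eq_zero_iff.2 hdet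
  refine hv (hind v ?_)
  set T := ∑ r, C (v r) * L r with hT
  -- The minor records the coefficients of `x^(q-1), …, x^(q-p)`, and `q - p ≤ deg g`; so the
  -- combination `T` has no term of degree `deg g` or more.
  have hcoeff : ∀ i, g.natDegree ≤ i → T.coeff i = 0 := by
    intro i hi
    by_cases hiq : i < q
    · have := congrFun hvM ⟨q - 1 - i, by omega⟩
      simp only [Matrix.vecMul, dotProduct, Matrix.of_apply, Pi.zero_apply] at this
      rw [show q - 1 - (q - 1 - i) = i by omega] at this
      simpa [hT, finsetSum_coeff] using this
    · rw [hT, finsetSum_coeff]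
      refine Finset.sum_eq_zero fun r _ => ?_
      rw [coeff_C_mul, coeff_eq_zero_of_natDegree_lt ((hL r).trans_le (not_lt.1 hiq)), mul_zero]
  have hdvd : g ∣ T := Finset.dvd_sum fun r _ => (hg r).mul_left _
  by_contra hT0
  exact hT0 (leadingCoeff_eq_zero.1 (hcoeff _ (natDegree_le_of_dvd hdvd hT0)))

/-- Independence of the shifts of two polynomials with coprime cofactors. -/
theorem shifts_independent {K ι : Type*} [Field K] [Fintype ι] {U V : K[X]} (hU : U ≠ 0)
    (hUV : IsCoprime U V) (k : ι → ℕ) (e : ι → Prop) [DecidablePred e]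
    (hinj : ∀ r r', (e r ↔ e r') → k r = k r' → r = r')
    (hk : ∀ r, ¬ e r → k r < U.natDegree) (v : ι → K)
    (hv : ∑ r, C (v r) * (X ^ k r * if e r then U else V) = 0) : v = 0 := by
  classical
  have hcoeff : ∀ (S : Finset ι), (∀ r ∈ S, ∀ r' ∈ S, k r = k r' → r = r') →
      ∑ r ∈ S, C (v r) * X ^ k r = 0 → ∀ r ∈ S, v r = 0 := by
    intro S hS h0 r hr
    have := congrArg (fun f => coeff f (k r)) h0
    simp only [finsetSum_coeff, coeff_C_mul, coeff_X_pow, coeff_zero] at this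
    rw [Finset.sum_eq_single r (fun r' hr' hne => ?_) (absurd hr)] at this
    · simpa using this
    · rw [if_neg fun h => hne (hS r hr r' hr' h).symm, mul_zero]
  obtain ⟨A, hA⟩ : ∃ A, A = ∑ r with e r, C (v r) * X ^ k r := ⟨_, rfl⟩
  obtain ⟨B, hB⟩ : ∃ B, B = ∑ r with ¬ e r, C (v r) * X ^ k r := ⟨_, rfl⟩
  have hAB : A * U + B * V = 0 := by
    refine Eq.trans ?_ hv
    rw [← Finset.sum_filter_add_sum_filter_not Finset.univ e, hA, hB, Finset.sum_mul,
      Finset.sum_mul]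
    congr 1
    · refine Finset.sum_congr rfl fun r hr => ?_
      rw [if_pos (Finset.mem_filter.1 hr).2, mul_assoc]
    · refine Finset.sum_congr rfl fun r hr => ?_
      rw [if_neg (Finset.mem_filter.1 hr).2, mul_assoc]
  -- `U` divides `B V`, hence `B`, whose exponents all lie below `deg U`.
  have hB0 : B = 0 := by
    refine eq_zero_of_dvd_of_degree_lt (hUV.dvd_of_dvd_mul_right ⟨-A, ?_⟩) ?_
    · linear_combination hAB
    · rw [degree_eq_natDegree hU, degree_lt_iff_coeff_zero]
      intro i hi
      rw [hB, finsetSum_coeff]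
      refine Finset.sum_eq_zero fun r hr => ?_
      have := hk r (Finset.mem_filter.1 hr).2
      rw [coeff_C_mul, coeff_X_pow, if_neg (by omega), mul_zero]
  have hA0 : A = 0 := by
    rw [hB0, zero_mul, add_zero] at hAB
    exact (mul_eq_zero.1 hAB).resolve_right hU
  funext r
  by_cases hr : e r
  · refine hcoeff _ (fun r₁ h₁ r₂ h₂ => hinj r₁ r₂ ?_) (hA.symm.trans hA0) r (by simp [hr])
    simp [(Finset.mem_filter.1 h₁).2, (Finset.mem_filter.1 h₂).2]
  · refine hcoeff _ (fun r₁ h₁ r₂ h₂ => hinj r₁ r₂ ?_) (hB.symm.trans hB0) r (by simp [hr])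
    simp [(Finset.mem_filter.1 h₁).2, (Finset.mem_filter.1 h₂).2]

/-! ### Discriminant sequences -/

/-- The last member of the discriminant sequence of a separable polynomial does not vanish. -/
theorem discrSeq_natDegree_ne_zero {K : Type*} [Field K] {Q : K[X]} (hQ : Q ≠ 0)
    (hsep : Q.Separable) : discrSeq Q Q.natDegree ≠ 0 := by
  set s := Q.natDegree with hs
  let L : Fin (2 * s) → K[X] := fun r =>
    X ^ (s - 1 - r.val / 2) * if r.val % 2 = 0 then Q else derivative Q
  have hdeg : ∀ r : Fin (2 * s), (if r.val % 2 = 0 then Q else derivative Q).natDegree ≤ s := by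
    intro r
    split_ifs
    · exact le_rfl
    · exact (natDegree_derivative_le Q).trans (Nat.sub_le _ _)
  have hLdeg : ∀ r, (L r).natDegree < 2 * s := by
    intro r
    refine natDegree_mul_le.trans_lt ?_
    have h1 := hdeg r
    have h2 := natDegree_X_pow_le (R := K) (s - 1 - r.val / 2)
    have := r.isLt
    omega
  have hmat : discrBlock Q (2 * s) =
      Matrix.of fun (r c : Fin (2 * s)) => (L r).coeff (2 * s - 1 - c.val) := by
    ext r c
    have hr := r.isLt
    have hc := c.isLt
    have hd := hdeg r
    simp only [discrBlock, Matrix.of_apply, ← hs, L, coeff_X_pow_mul']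
    by_cases h1 : r.val / 2 ≤ c.val
    · by_cases h2 : c.val ≤ r.val / 2 + s
      · rw [if_pos ⟨h1, h2⟩]
        split_ifs with h3 h4 h4
        all_goals congr 1; omega
      · rw [if_neg (by omega), if_neg (by omega)]
    · rw [if_neg (by omega)]
      split_ifs with h3 h4
      · rw [if_pos h4] at hd
        exact (coeff_eq_zero_of_natDegree_lt (by omega)).symm
      · rw [if_neg h4] at hd
        exact (coeff_eq_zero_of_natDegree_lt (by omega)).symm
      · rfl
  rw [discrSeq, hmat]
  -- The matrix is square and holds all coefficients of its rows, so `g = 1` suffices.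
  refine det_leadingCoeffs_ne_zero L hLdeg 1 (fun r => one_dvd _) (by simp) fun v hv => ?_
  refine shifts_independent hQ hsep (fun r : Fin (2 * s) => s - 1 - r.val / 2)
    (fun r => r.val % 2 = 0) ?_ ?_ v hv
  · intro r r' h1 h2
    have := r.isLt
    have := r'.isLt
    ext
    omega
  · intro r _
    have := r.isLt
    omega

/-- The layout of the discrimination matrix depends on the degree, so the degree must survive the
map. -/
theorem map_discrSeq {R S : Type*} [CommRing R] [CommRing S] (φ : R →+* S) (Q : R[X])
    (h : (Q.map φ).natDegree = Q.natDegree) (j : ℕ) :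
    φ (discrSeq Q j) = discrSeq (Q.map φ) j := by
  rw [discrSeq, discrSeq, RingHom.map_det]
  congr 1
  ext r c
  simp only [discrBlock, RingHom.mapMatrix_apply, Matrix.map_apply, Matrix.of_apply, h]
  split_ifs <;> simp [derivative_map, coeff_map]

theorem isHomogeneous_discrSeq {σ R : Type*} [CommRing R] {d : ℕ} (Q : (MvPolynomial σ R)[X])
    (hQ : ∀ i, (Q.coeff i).IsHomogeneous d) (j : ℕ) :
    (discrSeq Q j).IsHomogeneous (2 * j * d) := by
  refine isHomogeneous_det _ fun r c => ?_
  simp only [discrBlock, Matrix.of_apply]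
  split_ifs
  · exact hQ _
  · rw [coeff_derivative]
    have := (hQ (Q.natDegree + r.val / 2 - c.val + 1)).mul
      (MvPolynomial.isHomogeneous_C σ (((Q.natDegree + r.val / 2 - c.val : ℕ) : R) + 1))
    simpa using this
  · exact MvPolynomial.isHomogeneous_zero _ _ _

/-! ### The generic polynomial and its subresultants -/

theorem coeff_genericPoly (n i : ℕ) :
    (genericPoly n).coeff i = if h : i < n + 1 then MvPolynomial.X ⟨i, h⟩ else 0 := by
  simp only [genericPoly, finsetSum_coeff, coeff_C_mul, coeff_X_pow]
  split_ifs with h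
  · rw [Finset.sum_eq_single ⟨i, h⟩]
    · simp
    · intro j _ hj
      rw [if_neg fun e => hj (Fin.ext e.symm), mul_zero]
    · simp
  · refine Finset.sum_eq_zero fun j _ => ?_
    rw [if_neg (by omega), mul_zero]

theorem natDegree_genericPoly (n : ℕ) : (genericPoly n).natDegree = n := by
  refine natDegree_eq_of_le_of_coeff_ne_zero ?_ ?_
  · rw [natDegree_le_iff_coeff_eq_zero]
    intro i hi
    rw [coeff_genericPoly, dif_neg (by omega)]
  · rw [coeff_genericPoly, dif_pos (by omega)]
    exact MvPolynomial.X_ne_zero _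

theorem natDegree_derivs_zero (n : ℕ) : (derivs n 0).natDegree = n := natDegree_genericPoly n

theorem natDegree_derivs_le (n k : ℕ) : (derivs n k).natDegree ≤ n - k := by
  have := natDegree_iterate_derivative (genericPoly n) k
  rwa [natDegree_genericPoly] at this

theorem natDegree_derivs_one (n : ℕ) (hn : 1 ≤ n) : (derivs n 1).natDegree = n - 1 := by
  refine natDegree_eq_of_le_of_coeff_ne_zero (natDegree_derivs_le n 1) ?_
  rw [derivs, Function.iterate_one, coeff_derivative, coeff_genericPoly, dif_pos (by omega)]
  exact mul_ne_zero (MvPolynomial.X_ne_zero _) (Nat.cast_add_one_ne_zero _)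

theorem isHomogeneous_coeff_derivs (n k i : ℕ) : ((derivs n k).coeff i).IsHomogeneous 1 := by
  rw [derivs, coeff_iterate_derivative, nsmul_eq_mul]
  have hX : ((genericPoly n).coeff (i + k)).IsHomogeneous 1 := by
    rw [coeff_genericPoly]
    split_ifs
    · exact MvPolynomial.isHomogeneous_X _ _
    · exact MvPolynomial.isHomogeneous_zero _ _ _
  simpa using
    (MvPolynomial.isHomogeneous_C (Fin (n + 1)) (((i + k).descFactorial k : ℕ) : ℤ)).mul hX

/-- The degrees of the derivatives decrease and no entry exceeds the head, so the maximal shift is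
`n - 1 + a`, attained at the first entry. -/
theorem deltaZero_derivs {n a : ℕ} {l : List ℕ} (hn : 1 ≤ n) (ha : 1 ≤ a)
    (hl : ∀ b ∈ l, b ≤ a) : deltaZero (derivs n) (a :: l) = a - 1 := by
  have hmax : maxShift (derivs n) (a :: l) = n - 1 + a := by
    refine le_antisymm (Finset.sup_le fun k _ => ?_) ?_
    · have h1 := natDegree_derivs_le n (k + 1)
      have h2 : (a :: l).getD k 0 ≤ a := by
        rw [List.getD_eq_getElem?_getD]
        rcases h : (a :: l)[k]? with _ | b
        · simp
        · rcases List.mem_cons.1 (List.mem_of_getElem? h) with rfl | hb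
          · exact le_rfl
          · exact hl b hb
      omega
    · rw [← natDegree_derivs_one n hn]
      exact Finset.le_sup (f := fun k => (derivs n (k + 1)).natDegree + (a :: l).getD k 0)
        (b := 0) (by simp; omega)
  rw [deltaZero, hmax, natDegree_derivs_zero, if_pos (by omega)]
  omega

theorem length_sylvesterRows {R : Type*} [CommRing R] (F : ℕ → R[X]) (δ : List ℕ) :
    (sylvesterRows F δ).length = deltaZero F δ + δ.sum := by
  have : ∀ (l : List ℕ) (m : ℕ), ((l.zipIdx m).flatMap
      (fun di => (List.range di.1).reverse.map (fun k => X ^ k * F di.2))).length = l.sum := by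
    intro l
    induction l with
    | nil => simp
    | cons a l ih => intro m; simp [List.zipIdx_cons]
  rw [sylvesterRows, this, List.sum_cons]

/-- The entries are linear in the parameters, so the degree is the number of rows. -/
theorem isHomogeneous_coeff_subres (n : ℕ) (δ : List ℕ) (i : ℕ) :
    ((subres (derivs n) δ).coeff i).IsHomogeneous (deltaZero (derivs n) δ + δ.sum) := by
  rw [← length_sylvesterRows, subres]
  split_ifs with h
  · have := isHomogeneous_coeff_detPoly (d := 1) h (sylvesterMatrix (derivs n) δ) (fun r c => ?_) i
    · rwa [mul_one] at this
    · have hr := List.get_mem (sylvesterRows (derivs n) δ) r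
      obtain ⟨di, -, hdi⟩ := List.mem_flatMap.1 hr
      obtain ⟨k, -, hk⟩ := List.mem_map.1 hdi
      rw [sylvesterMatrix, Matrix.of_apply, ← hk, coeff_X_pow_mul']
      split_ifs
      · exact isHomogeneous_coeff_derivs _ _ _
      · exact MvPolynomial.isHomogeneous_zero _ _ _
  · exact MvPolynomial.isHomogeneous_zero _ _ _

theorem get_sylvesterRows_singleton {R : Type*} [CommRing R] (F : ℕ → R[X]) (t d : ℕ)
    (hd : deltaZero F [t] = d) (r : Fin (sylvesterRows F [t]).length) :
    (sylvesterRows F [t]).get r =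
      X ^ (if r.val < d then d - 1 - r.val else t - 1 - (r.val - d)) *
        if r.val < d then F 0 else F 1 := by
  have h : sylvesterRows F [t] = (List.range d).reverse.map (fun k => X ^ k * F 0) ++
      (List.range t).reverse.map (fun k => X ^ k * F 1) := by
    simp [sylvesterRows, hd, List.zipIdx_cons]
  rw [List.get_eq_getElem, List.getElem_of_eq h, List.getElem_append]
  simp only [List.length_map, List.length_reverse, List.length_range]
  split_ifs <;> simp

/-! ### Specialization and nonvanishing -/

/-- The specialization of the parameters to the coefficients of `f`. -/
def specialize {K : Type*} [CommRing K] (n : ℕ) (f : K[X]) : Param n →+* K :=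
  MvPolynomial.eval₂Hom (Int.castRingHom K) fun i => f.coeff i

theorem map_specialize_derivs {K : Type*} [CommRing K] {n : ℕ} {f : K[X]} (hf : f.natDegree ≤ n)
    (k : ℕ) : (derivs n k).map (specialize n f) = derivative^[k] f := by
  have h0 : (genericPoly n).map (specialize n f) = f := by
    ext i
    rw [coeff_map, coeff_genericPoly]
    split_ifs with h
    · simp [specialize]
    · rw [map_zero, coeff_eq_zero_of_natDegree_lt (by omega)]
  rw [derivs, ← iterate_derivative_map, h0]

/-- The minor of the columns `1, …, p - 1, q - i` for `i = q - p` is the leading one. -/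
theorem coeff_detPoly_sub {R : Type*} [CommRing R] {p q : ℕ} (h : p ≤ q) (L : Fin p → R[X]) :
    (detPoly h (Matrix.of fun r (c : Fin q) => (L r).coeff (q - 1 - c.val))).coeff (q - p) =
      (Matrix.of fun (r c : Fin p) => (L r).coeff (q - 1 - c.val)).det := by
  rw [coeff_detPoly, if_pos (Nat.lt_succ_self _)]
  congr 1
  ext r c
  have := c.isLt
  simp only [Matrix.submatrix_apply, id, Matrix.of_apply, detPolyCols]
  congr 1
  split_ifs <;> omega

/-- If independent row polynomials are multiples of a polynomial `g` of degree `q - p`, then their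
determinant polynomial is a nonzero constant times `g`. -/
theorem detPoly_eq_C_mul {K : Type*} [Field K] {p q : ℕ} (hp : 0 < p) (h : p ≤ q)
    (L : Fin p → K[X]) (hL : ∀ r, (L r).natDegree < q) {g : K[X]} (hg0 : g ≠ 0)
    (hg : ∀ r, g ∣ L r) (hgq : g.natDegree = q - p)
    (hind : ∀ v : Fin p → K, ∑ r, C (v r) * L r = 0 → v = 0) :
    ∃ a : K, a ≠ 0 ∧
      detPoly h (Matrix.of fun r (c : Fin q) => (L r).coeff (q - 1 - c.val)) = C a * g := by
  have hcoeff := det_leadingCoeffs_ne_zero L hL g hg (by omega) hind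
  rw [← coeff_detPoly_sub h] at hcoeff
  have hdeg := natDegree_detPoly_le h
    (Matrix.of fun r (c : Fin q) => (L r).coeff (q - 1 - c.val))
  obtain ⟨a, ha⟩ := dvd_detPoly hp h L hL g hg
  rw [ha] at hcoeff hdeg ⊢
  have ha0 : a ≠ 0 := by
    rintro rfl
    rw [mul_zero, coeff_zero] at hcoeff
    exact hcoeff rfl
  rw [natDegree_mul hg0 ha0] at hdeg
  have haC := eq_C_of_natDegree_eq_zero (by omega : a.natDegree = 0)
  refine ⟨a.coeff 0, fun h => ha0 (by rw [haC, h, C_0]), ?_⟩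
  rw [← haC, mul_comm]

/-- If `f = g u`, `f' = g w` with `u`, `w` coprime, then the subresultant of order `deg u` of the
generic polynomial and its derivative specializes to a nonzero multiple of `g`. -/
theorem map_specialize_subres {K : Type*} [Field K] {n t s : ℕ} (ht : 1 ≤ t) (hn : s + t = n)
    {f g u w : K[X]} (hf : f = g * u) (hf' : derivative f = g * w) (huw : IsCoprime u w)
    (hu : u.natDegree = t) (hg : g.natDegree = s) (hg0 : g ≠ 0) :
    (subres (derivs n) [t]).natDegree ≤ s ∧
      ∃ a : K, a ≠ 0 ∧ (subres (derivs n) [t]).map (specialize n f) = C a * g := by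
  have hu0 : u ≠ 0 := by rintro rfl; simp at hu; omega
  have hfn : f.natDegree = n := by rw [hf, natDegree_mul hg0 hu0, hg, hu, hn]
  have hd : deltaZero (derivs n) [t] = t - 1 := deltaZero_derivs (by omega) ht (by simp)
  have hp := length_sylvesterRows (derivs n) [t]
  rw [hd, List.sum_singleton] at hp
  have hq : deltaZero (derivs n) [t] + (derivs n 0).natDegree = t - 1 + n := by
    rw [hd, natDegree_derivs_zero]
  have hpq : (sylvesterRows (derivs n) [t]).length ≤
      deltaZero (derivs n) [t] + (derivs n 0).natDegree := by rw [hp, hq]; omega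
  rw [subres, dif_pos hpq]
  refine ⟨(natDegree_detPoly_le _ _).trans (by rw [hp, hq]; omega), ?_⟩
  rw [map_detPoly]
  have hM : (sylvesterMatrix (derivs n) [t]).map (specialize n f) =
      Matrix.of fun r (c : Fin (deltaZero (derivs n) [t] + (derivs n 0).natDegree)) =>
        (X ^ (if r.val < t - 1 then t - 1 - 1 - r.val else t - 1 - (r.val - (t - 1))) *
          if r.val < t - 1 then f else derivative f).coeff
          (deltaZero (derivs n) [t] + (derivs n 0).natDegree - 1 - c.val) := by
    ext r c
    rw [Matrix.map_apply, sylvesterMatrix, Matrix.of_apply, ← coeff_map, Matrix.of_apply,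
      get_sylvesterRows_singleton _ t _ hd, Polynomial.map_mul, Polynomial.map_pow, map_X,
      apply_ite (Polynomial.map _), map_specialize_derivs hfn.le, map_specialize_derivs hfn.le]
    rfl
  rw [hM]
  clear hM
  -- Only `p = 2t - 1` and `q = n + t - 1` matter from here on; they give `q - p = n - t = s = deg
  -- g`.
  generalize (sylvesterRows (derivs n) [t]).length = p at *
  generalize deltaZero (derivs n) [t] + (derivs n 0).natDegree = q at *
  have hfac : ∀ r : Fin p, (if r.val < t - 1 then f else derivative f) =
      g * if r.val < t - 1 then u else w := by
    intro r
    split_ifs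
    · exact hf
    · exact hf'
  refine detPoly_eq_C_mul (by omega) hpq
    (fun r => X ^ (if r.val < t - 1 then t - 1 - 1 - r.val else t - 1 - (r.val - (t - 1))) *
      if r.val < t - 1 then f else derivative f) (fun r => ?_) hg0 (fun r => ?_) (by omega)
    fun v hv => ?_
  · refine natDegree_mul_le.trans_lt ?_
    have h1 := natDegree_derivative_le f
    have h2 := r.isLt
    rw [natDegree_X_pow]
    split_ifs with h <;> omega
  · rw [hfac]
    exact (dvd_mul_right _ _).mul_left _
  -- After cancelling `g` the rows are `t - 1` shifts of `u` and `t` shifts of `w`, the latter with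
  -- exponents below `t = deg u`.
  · refine shifts_independent hu0 huw
      (fun r : Fin p => if r.val < t - 1 then t - 1 - 1 - r.val else t - 1 - (r.val - (t - 1)))
      (fun r => r.val < t - 1) ?_ ?_ v ?_
    · intro r r' h1 h2
      have := r.isLt
      have := r'.isLt
      ext
      split_ifs at h2 <;> omega
    · intro r h
      rw [if_neg h]
      omega
    · refine (mul_eq_zero.1 (Eq.trans ?_ hv)).resolve_left hg0
      rw [Finset.mul_sum]
      refine Finset.sum_congr rfl fun r _ => ?_
      rw [hfac]
      ring

/-- It suffices that one specialization does not vanish; `g²h` with `g = x^s - 1` and `h = x^(t-s)`,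
which is `1` or `x`, serves. -/
theorem discrSeq_subres_ne_zero {n t s : ℕ} (hs : 1 ≤ s) (hst : s ≤ t) (hts : t ≤ s + 1)
    (hn : s + t = n) : discrSeq (subres (derivs n) [t]) s ≠ 0 := by
  have hsQ : (s : ℚ) ≠ 0 := by exact_mod_cast (by omega : s ≠ 0)
  let g : ℚ[X] := X ^ s - C 1
  let h : ℚ[X] := X ^ (t - s)
  have hgdeg : g.natDegree = s := natDegree_X_pow_sub_C
  have hg0 : g ≠ 0 := X_pow_sub_C_ne_zero (by omega) 1
  have hh0 : h ≠ 0 := pow_ne_zero _ X_ne_zero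
  have hgsep : g.Separable := separable_X_pow_sub_C 1 hsQ one_ne_zero
  have hgh : IsCoprime g h := by
    refine IsCoprime.pow_right ⟨-1, X ^ (s - 1), ?_⟩
    have : (X : ℚ[X]) ^ s = X ^ (s - 1) * X := by rw [← pow_succ]; congr 1; omega
    simp only [g, this, C_1]
    ring
  have hhsep : IsCoprime h (derivative h) := by
    rcases (by omega : t - s = 0 ∨ t - s = 1) with e | e
    · simp only [h, e, pow_zero]
      exact isCoprime_one_left
    · simp only [h, e, pow_one, derivative_X]
      exact isCoprime_one_right
  let w : ℚ[X] := 2 * derivative g * h + g * derivative h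
  have h2 : IsCoprime g (2 : ℚ[X]) := by
    refine ⟨0, C 2⁻¹, ?_⟩
    rw [zero_mul, zero_add, show (2 : ℚ[X]) = C 2 from rfl, ← C_mul, inv_mul_cancel₀ two_ne_zero,
      C_1]
  -- Modulo `g`, `w` is `2g'h`; modulo `h`, it is `gh'`. Both are units there.
  have huw : IsCoprime (g * h) w := by
    refine IsCoprime.mul_left ?_ ?_
    · exact (IsCoprime.add_mul_left_right_iff).2 ((h2.mul_right hgsep).mul_right hgh)
    · have : w = g * derivative h + h * (2 * derivative g) := by simp only [w]; ring
      rw [this]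
      exact (IsCoprime.add_mul_left_right_iff).2 (hgh.symm.mul_right hhsep)
  obtain ⟨hle, c, hc, hmap⟩ := map_specialize_subres (by omega) hn
    (rfl : g * (g * h) = g * (g * h)) (w := w)
    (by simp only [derivative_mul, w]; ring) huw
    (by rw [natDegree_mul hg0 hh0, hgdeg, natDegree_X_pow]; omega) hgdeg hg0
  have hmapdeg : ((subres (derivs n) [t]).map (specialize n (g * (g * h)))).natDegree = s := by
    rw [hmap, natDegree_C_mul hc, hgdeg]
  -- The degree is at most `s` before specialization and equal to `s` after it, so it does not drop.
  have hdeg : (subres (derivs n) [t]).natDegree = s :=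
    hle.antisymm (hmapdeg.symm.le.trans natDegree_map_le)
  intro h0
  have key := map_discrSeq (specialize n (g * (g * h))) _ (hmapdeg.trans hdeg.symm) s
  rw [h0, map_zero] at key
  have hne := discrSeq_natDegree_ne_zero
    (Q := (subres (derivs n) [t]).map (specialize n (g * (g * h))))
    (by rw [hmap]; exact mul_ne_zero (C_ne_zero.2 hc) hg0)
    (by rw [hmap]; exact (hgsep.unit_mul ((isUnit_C (x := c)).2 hc.isUnit)))
  rw [hmapdeg] at hne
  exact hne key.symm

/-! ### Conjugate partitions -/

theorem conjPart_antitone (μ : List ℕ) : Antitone (conjPart μ) := by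
  intro i j hij
  refine List.countP_mono_left fun a _ h => ?_
  simp only [decide_eq_true_eq] at h ⊢
  omega

/-- Double counting: an entry `a` of `μ` contributes `min a m` to the left side. -/
theorem sum_conjPart_le (μ : List ℕ) (m : ℕ) :
    ∑ i ∈ Finset.range m, conjPart μ (i + 1) ≤ μ.sum := by
  induction μ with
  | nil => simp [conjPart]
  | cons a μ ih =>
    have hsplit : ∀ i, conjPart (a :: μ) i = conjPart μ i + if i ≤ a then 1 else 0 := by
      intro i
      simp [conjPart, List.countP_cons]
    have hcard : ∑ i ∈ Finset.range m, (if i + 1 ≤ a then 1 else 0) ≤ a := by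
      rw [← Finset.card_filter]
      calc _ ≤ (Finset.range a).card := Finset.card_le_card fun i hi => by
            simp only [Finset.mem_filter, Finset.mem_range] at hi ⊢
            omega
        _ = a := Finset.card_range a
    simp only [hsplit, Finset.sum_add_distrib, List.sum_cons]
    omega

theorem take_conj (n : ℕ) (μ : List ℕ) {i : ℕ} (hi : i + 1 ≤ n) :
    (conj n μ).take (i + 1) =
      conjPart μ 1 :: (List.range i).map (fun k => conjPart μ (k + 2)) := by
  rw [conj, ← List.map_take, List.take_range, min_eq_left hi, List.range_succ_eq_map]
  simp [Function.comp_def]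

theorem isHomogeneous_coeff_subres_cons {n a : ℕ} {l : List ℕ} (hn : 1 ≤ n) (ha : 1 ≤ a)
    (hl : ∀ b ∈ l, b ≤ a) (i : ℕ) :
    ((subres (derivs n) (a :: l)).coeff i).IsHomogeneous (a - 1 + (a :: l).sum) := by
  have := isHomogeneous_coeff_subres n (a :: l) i
  rwa [deltaZero_derivs hn ha hl] at this

theorem length_le_sum {μ : List ℕ} (h : ∀ a ∈ μ, 1 ≤ a) : μ.length ≤ μ.sum := by
  simpa using List.card_nsmul_le_sum μ 1 h

theorem conjPart_one {μ : List ℕ} (h : ∀ a ∈ μ, 1 ≤ a) : conjPart μ 1 = μ.length := by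
  rw [conjPart, List.countP_eq_length]
  simpa using h

theorem IsMult.ne_nil {n : ℕ} {μ : List ℕ} (h : IsMult n μ) (hn : 1 ≤ n) : μ ≠ [] := by
  rintro rfl
  have := h.2.2
  simp at this
  omega

theorem IsMult.one_le_conjPart {n : ℕ} {μ : List ℕ} (h : IsMult n μ) (hn : 1 ≤ n) :
    1 ≤ conjPart μ 1 := by
  rw [conjPart_one h.2.1]
  exact List.length_pos_iff.2 (h.ne_nil hn)

/-! ### The upper bound -/

/-- Zeros are allowed after the head, so that the bound also covers `conj n μ`, which is padded to
length `n`. -/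
theorem totalDegree_multDiscr_le {n a : ℕ} {l : List ℕ} (hn : 1 ≤ n) (ha : 1 ≤ a)
    (hl : ∀ b ∈ l, b ≤ a) (hsum : (a :: l).sum ≤ n) :
    (multDiscr n (a :: l)).totalDegree ≤ 2 * n - 1 := by
  refine (isHomogeneous_coeff_subres_cons hn ha hl 0).totalDegree_le.trans ?_
  rw [List.sum_cons] at hsum ⊢
  omega

theorem sum_take_conj (n : ℕ) (μ : List ℕ) {i : ℕ} (hi : i ≤ n) :
    ((conj n μ).take i).sum = ∑ k ∈ Finset.range i, conjPart μ (k + 1) := by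
  rw [conj, ← List.map_take, List.take_range, min_eq_left hi]
  rfl

theorem totalDegree_multDiscr_conj_le {n : ℕ} {μ : List ℕ} (hn : 1 ≤ n) (hμ : IsMult n μ) :
    (multDiscr n (conj n μ)).totalDegree ≤ 2 * n - 1 := by
  obtain ⟨m, rfl⟩ : ∃ m, n = m + 1 := ⟨n - 1, by omega⟩
  have htake : (conj (m + 1) μ).take (m + 1) = conj (m + 1) μ :=
    List.take_of_length_le (by simp [conj])
  have hsum := (sum_take_conj (m + 1) μ le_rfl).trans_le (sum_conjPart_le μ _)
  rw [hμ.2.2, take_conj _ _ le_rfl] at hsum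
  rw [← htake, take_conj _ _ le_rfl]
  refine totalDegree_multDiscr_le hn (hμ.one_le_conjPart hn) (fun b hb => ?_) hsum
  obtain ⟨k, -, rfl⟩ := List.mem_map.1 hb
  exact conjPart_antitone μ (by omega)

theorem totalDegree_discrSeq_incGcd_le {n i j : ℕ} {μ : List ℕ} (hn : 3 ≤ n) (hμ : IsMult n μ)
    (hi : i < μ.headD 0) (hj : j ≤ conjPart μ (i + 1)) :
    (discrSeq (incGcd n μ i) j).totalDegree ≤ n * (n - 1) := by
  -- For `G₀ = P` the coefficients are linear, so the degree is at most `2n`; here `n ≥ 3` enters.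
  rcases i with _ | i
  · have hhom := isHomogeneous_discrSeq (incGcd n μ 0) (isHomogeneous_coeff_derivs n 0) j
    refine hhom.totalDegree_le.trans ?_
    have h1 := length_le_sum hμ.2.1
    rw [zero_add, conjPart_one hμ.2.1] at hj
    rw [hμ.2.2] at h1
    have h2 : n * 2 ≤ n * (n - 1) := Nat.mul_le_mul_left n (by omega)
    omega
  · have hin : i + 2 ≤ n := by
      obtain ⟨a, l, rfl⟩ := List.exists_cons_of_ne_nil (hμ.ne_nil (by omega))
      have := hμ.2.2
      simp only [List.headD_cons, List.sum_cons] at hi this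
      omega
    have ha := hμ.one_le_conjPart (by omega : 1 ≤ n)
    have hsum := sum_conjPart_le μ (i + 2)
    rw [Finset.sum_range_succ, ← sum_take_conj n μ (by omega : i + 1 ≤ n), take_conj _ _ (by omega),
      hμ.2.2] at hsum
    have hsa := conjPart_antitone μ (by omega : 1 ≤ i + 1 + 1)
    have hhom := isHomogeneous_discrSeq (incGcd n μ (i + 1))
      (d := conjPart μ 1 - 1 +
        (conjPart μ 1 :: (List.range i).map (fun k => conjPart μ (k + 2))).sum) (fun c => ?_) j
    · refine hhom.totalDegree_le.trans ?_
      rw [List.sum_cons] at hsum ⊢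
      generalize conjPart μ 1 = a at *
      generalize conjPart μ (i + 1 + 1) = s at *
      generalize ((List.range i).map (fun k => conjPart μ (k + 2))).sum = T at *
      -- `s ≤ a` and `a + T + s ≤ n` give `2s ≤ n`. In terms of `m = n - 2s` the two sides of the
      -- final inequality differ by `m² - m`, which is zero exactly for `m = 0, 1`.
      obtain ⟨m, rfl⟩ : ∃ m, n = 2 * s + m := ⟨n - 2 * s, by omega⟩
      calc 2 * j * (a - 1 + (a + T)) ≤ 2 * s * (2 * s + 2 * m - 1) :=
            Nat.mul_le_mul (by omega) (by omega)
        _ ≤ (2 * s + m) * (2 * s + m - 1) := by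
            have hm : m ≤ m * m := Nat.le_mul_self m
            zify [(by omega : 1 ≤ 2 * s + 2 * m), (by omega : 1 ≤ 2 * s + m)] at hm ⊢
            nlinarith
    · rw [incGcd, if_neg (Nat.succ_ne_zero _), take_conj _ _ (by omega)]
      refine isHomogeneous_coeff_subres_cons (by omega) ha (fun b hb => ?_) c
      obtain ⟨k, -, rfl⟩ := List.mem_map.1 hb
      exact conjPart_antitone μ (by omega)

theorem totalDegree_le_of_mem_conditionPolys {n : ℕ} (hn : 3 ≤ n) {p : Param n}
    (hp : p ∈ conditionPolys n) : p.totalDegree ≤ n * (n - 1) := by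
  have hn2 : 2 * n - 1 ≤ n * (n - 1) := by
    have h2 : n * 2 ≤ n * (n - 1) := Nat.mul_le_mul_left n (by omega)
    omega
  obtain ⟨o, ⟨μ, μR, μI, hμ, -, -, rfl⟩, A, (⟨γ, hγ, -, rfl⟩ | rfl) | ⟨i, hi, rfl⟩, hpA⟩ := hp
  · obtain rfl : p = multDiscr n γ := hpA
    obtain ⟨a, l, rfl⟩ := List.exists_cons_of_ne_nil (hγ.ne_nil (by omega))
    exact (totalDegree_multDiscr_le (by omega) (hγ.2.1 a (by simp))
      (List.pairwise_cons.1 hγ.1).1 hγ.2.2.le).trans hn2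
  · obtain rfl : p = multDiscr n (conj n μ) := hpA
    exact (totalDegree_multDiscr_conj_le (by omega) hμ).trans hn2
  · obtain ⟨j, hj, rfl⟩ := List.mem_map.1 (show p ∈ List.map _ _ from hpA)
    exact totalDegree_discrSeq_incGcd_le hn hμ hi (List.mem_range.1 hj)

/-! ### Attainment -/

theorem exists_mem_conditionPolys_totalDegree_eq {n : ℕ} (hn : 3 ≤ n) :
    ∃ p ∈ conditionPolys n, p.totalDegree = n * (n - 1) := by
  obtain ⟨s, t, hst, hts, hsum⟩ : ∃ s t, s ≤ t ∧ t ≤ s + 1 ∧ s + t = n :=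
    ⟨n / 2, n - n / 2, by omega, by omega, by omega⟩
  obtain ⟨s, rfl⟩ : ∃ s', s = s' + 1 := ⟨s - 1, by omega⟩
  -- The conjugate of this `μ` is `(t, s + 1)`, where `s + 1 = ⌊n/2⌋`.
  let μ : List ℕ := List.replicate (s + 1) 2 ++ List.replicate (t - (s + 1)) 1
  have hμ : IsMult n μ := by
    refine ⟨?_, ?_, ?_⟩
    · simp only [μ, List.pairwise_append, List.mem_replicate]
      refine ⟨List.pairwise_replicate.2 (Or.inr le_rfl),
        List.pairwise_replicate.2 (Or.inr le_rfl), ?_⟩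
      rintro a ⟨-, rfl⟩ b ⟨-, rfl⟩
      decide
    · simp only [μ, List.mem_append, List.mem_replicate]
      rintro a (⟨-, rfl⟩ | ⟨-, rfl⟩) <;> decide
    · simp only [μ, List.sum_append, List.sum_replicate, smul_eq_mul]
      omega
  have h1 : conjPart μ 1 = t := by
    rw [conjPart_one hμ.2.1]
    simp only [μ, List.length_append, List.length_replicate]
    omega
  have h2 : conjPart μ 2 = s + 1 := by
    simp [μ, conjPart, List.countP_replicate]
  have hG : incGcd n μ 1 = subres (derivs n) [t] := by
    rw [incGcd, if_neg one_ne_zero, take_conj n μ (i := 0) (by omega), h1]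
    rfl
  -- The splitting with all roots real is used, and the last entry of the `Var` list for `i = 1`.
  refine ⟨discrSeq (incGcd n μ 1) (s + 1), ⟨_, ⟨μ, μ, [], hμ, ?_, ?_, rfl⟩,
    .varEq ((List.range (conjPart μ 2)).map fun j => discrSeq (incGcd n μ 1) (j + 1))
      (conjPart [] 2 / 2), Or.inr ⟨1, ?_, rfl⟩, ?_⟩, ?_⟩
  · exact ⟨hμ.1, hμ.2.1, by simp, by simp, by simp, by simp, by simpa using hμ.2.2⟩
  · simp
  · simp [μ, List.replicate_succ]
  · exact List.mem_map.2 ⟨s, List.mem_range.2 (by omega), rfl⟩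
  · rw [hG]
    have hhom := isHomogeneous_discrSeq (subres (derivs n) [t])
      (isHomogeneous_coeff_subres_cons (by omega) (by omega) (by simp)) (s + 1)
    rw [hhom.totalDegree (discrSeq_subres_ne_zero (by omega) hst hts hsum), List.sum_singleton]
    obtain rfl | rfl : t = s + 1 ∨ t = s + 2 := by omega
    · obtain rfl : n = 2 * s + 2 := by omega
      simp only [show 2 * s + 2 - 1 = 2 * s + 1 by omega, Nat.add_sub_cancel]
      ring
    · obtain rfl : n = 2 * s + 3 := by omega
      simp only [show 2 * s + 3 - 1 = 2 * s + 2 by omega, show s + 2 - 1 = s + 1 by omega]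
      ring

end QXY

theorem proposition4 (n : ℕ) (hn : 3 ≤ n) :
    IsGreatest {d : ℕ | ∃ p ∈ QXY.conditionPolys n, MvPolynomial.totalDegree p = d}
      (n * (n - 1)) := by
  refine ⟨QXY.exists_mem_conditionPolys_totalDegree_eq hn, ?_⟩
  rintro d ⟨p, hp, rfl⟩
  exact QXY.totalDegree_le_of_mem_conditionPolys hn hp
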